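/- Let $q$ be a prime power, let $V$ be an $n$-dimensional vector space over the finite field $\mathbb{F}_q$, where $n\ge 3$ is odd, and let $k,l\ge 1$ be integers with $k,l\le \left(1-\frac{\sqrt2}{2}\right)q$. Let $\mathrm{V}_k$ be the poset on $k+1$ elements $x_1,\dots,x_k,y$ whose only strict relations are $x_i>y$ for $1\le i\le k$, and let $\Lambda_l$ be the poset obtained from $\mathrm{V}_l$ by reversing all relations. A family $\mathcal{F}$ of subspaces of $V$, ordered by inclusion, is called induced $\{\mathrm{V}_k,\Lambda_l\}$-free if for neither $P=\mathrm{V}_k$ nor $P=\Lambda_l$ is there an injection $\phi:P\to\mathcal{F}$ such that $x\le y$ if and only if $\phi(x)\subseteq\phi(y)$ for all $x,y\in P$. Let $\mathrm{La}^*_q(n,\{\mathrm{V}_k,\Lambda_l\})$ be the maximum size of an induced $\{\mathrm{V}_k,\Lambda_l\}$-free family of subspaces of $V$. Then $$\mathrm{La}^*_q(n,\{\mathrm{V}_k,\Lambda_l\})=\binom{n}{\frac{n-1}{2}}_q,\qquad\text{where}\quad \binom{n}{m}_q=\prod_{0\le i<m}\frac{q^{n-i}-1}{q^{m-i}-1},$$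 and every induced $\{\mathrm{V}_k,\Lambda_l\}$-free family of this maximum size is either the family of all $\frac{n-1}{2}$-dimensional subspaces of $V$ or the family of all $\frac{n+1}{2}$-dimensional subspaces of $V$. -/

import Mathlib

/-- The underlying set of the poset `V_k`: the elements `y` and `x i` for `i : Fin k`. -/
inductive VPoset (k : ℕ) : Type
  | y : VPoset k
  | x (i : Fin k) : VPoset k

instance VPoset.instFinite (k : ℕ) : Finite (VPoset k) :=
  Finite.of_surjective
    (fun o : Option (Fin k) => Option.casesOn (motive := fun _ => VPoset k) o VPoset.y VPoset.x)
    (by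
      rintro (_ | i)
      · exact ⟨none, rfl⟩
      · exact ⟨some i, rfl⟩)

noncomputable instance VPoset.instFintype (k : ℕ) : Fintype (VPoset k) :=
  Fintype.ofFinite _

/-- The order of `V_k`: the only strict relations are `y < x i`. -/
instance VPoset.instPartialOrder (k : ℕ) : PartialOrder (VPoset k) where
  le a b := a = VPoset.y ∨ a = b
  le_refl _ := Or.inr rfl
  le_trans a b c := by
    rintro (h | rfl)
    · exact fun _ => Or.inl h
    · exact id
  le_antisymm a b := by
    rintro (h | h) (h' | h')
    · exact h.trans h'.symm
    · exact h'.symm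
    · exact h
    · exact h

/-- The poset `Λ_k`: the poset `V_k` with all relations reversed. -/
abbrev LambdaPoset (k : ℕ) : Type := (VPoset k)ᵒᵈ

/-- A family of subspaces, ordered by inclusion, that contains no member of `Ps` as an
induced subposet (an injection `φ` with `φ x ≤ φ y ↔ x ≤ y` is an order embedding). -/
def InducedFree {K V : Type*} [Field K] [AddCommGroup V] [Module K V]
    (Ps : Set FinPartOrd.{0}) (F : Finset (Submodule K V)) : Prop :=
  ∀ P ∈ Ps, IsEmpty (P ↪o {W : Submodule K V // W ∈ F})

/-- `La*_q(n, Ps)`, for the lattice of subspaces of `V`: the maximum size of an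
induced `Ps`-free family of subspaces of `V`. -/
noncomputable def LaStar (K V : Type*) [Field K] [AddCommGroup V] [Module K V]
    (Ps : Set FinPartOrd.{0}) : ℕ :=
  sSup {m : ℕ | ∃ F : Finset (Submodule K V), InducedFree Ps F ∧ F.card = m}

/-- The set of all `d`-dimensional subspaces of `V`. -/
def level (K V : Type*) [Field K] [AddCommGroup V] [Module K V] (d : ℕ) :
    Set (Submodule K V) :=
  {W | Module.finrank K W = d}

/-- The Gaussian binomial coefficient `∏_{0 ≤ i < k} (q^(n-i) - 1) / (q^(k-i) - 1)`. -/
def qBinom (q n k : ℕ) : ℚ :=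
  ∏ i ∈ Finset.range k, ((q : ℚ) ^ (n - i) - 1) / ((q : ℚ) ^ (k - i) - 1)

/-! Write n = 2m+1, [j] = `qNum q j`, c = k-1, c' = l-1, and let N be the size of level m, which is
also that of level m+1. Subspaces of equal dimension are incomparable, so freeness gives every
member at most c members above it in each larger dimension and at most c' below it in each smaller
one (`FewAbove`, `FewBelow`). The upper bound uses nothing else.

If all dimensions are at most m, the lowest layer can be pushed up one dimension with a strict gain,
because a subspace below level m has many more upper covers than a subspace one dimension higher has
lower covers (`card_le_card_upperShadow_aux`). Duality handles dimensions at least m+1.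

In the mixed case the shadow bound, applied to all subfamilies, is Hall's condition. The low members
go injectively to m-dimensional spaces containing them (a set A), the high ones to (m+1)-dimensional
spaces inside them (a set B). An inclusion between A and B comes from a comparability in the family,
so there are at most c'm+1 incidences per member of B and cm+1 per member of A. If |A|+|B| ≥ N,
expander mixing (`card_incidences_ge`) forces at least G|A||B|/N incidences, with G = [m+1] - √q
[m]. Together these give G ≤ (cm+1)+(c'm+1), contradicting the bounds on k and l
(`incidence_bound_lt_gap`). -/

open Module Finset

/-- The `q`-analogue `1 + q + ⋯ + q ^ (j - 1)` of the natural number `j`. -/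
def qNum (q j : ℕ) : ℕ := ∑ i ∈ range j, q ^ i

lemma qNum_zero (q : ℕ) : qNum q 0 = 0 := by simp [qNum]

lemma qNum_succ (q j : ℕ) : qNum q (j + 1) = q * qNum q j + 1 := by
  simp only [qNum, sum_range_succ', mul_sum, pow_succ', pow_zero]

/-! ### Covers in the subspace lattice. -/

section Counting

variable {K V : Type*} [Field K] [AddCommGroup V] [Module K V]

section Level

variable [Finite V]

variable (K V) in
/-- The `d`-dimensional subspaces of a finite vector space. -/
noncomputable def dimSet (d : ℕ) : Finset (Submodule K V) := (Set.toFinite (level K V d)).toFinset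

@[simp]
lemma mem_dimSet {d : ℕ} {W : Submodule K V} : W ∈ dimSet K V d ↔ finrank K W = d := by
  simp [dimSet, level]

end Level

lemma card_atoms [Finite K] {j : ℕ} (h : finrank K V = j) :
    Nat.card {Y : Submodule K V // finrank K Y = 1} = qNum (Nat.card K) j := by
  rw [← Nat.card_congr (Projectivization.equivSubmodule K V), Projectivization.card_of_finrank K V h]
  rfl

lemma finrank_comap_mkQ [FiniteDimensional K V] (W : Submodule K V) (Y : Submodule K (V ⧸ W)) :
    finrank K (Y.comap W.mkQ) = finrank K Y + finrank K W := by
  have h1 := Submodule.finrank_quotient_add_finrank (Y.comap W.mkQ)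
  have h2 := Submodule.finrank_quotient_add_finrank Y
  have h3 := Submodule.finrank_quotient_add_finrank W
  have hle : W ≤ Y.comap W.mkQ := Submodule.le_comap_mkQ W Y
  have h4 := (Submodule.quotientQuotientEquivQuotient W (Y.comap W.mkQ) hle).finrank_eq
  rw [Submodule.map_comap_eq_of_surjective (Submodule.mkQ_surjective W)] at h4
  omega

open scoped Classical in
-- Upper covers of W are the lines of V ⧸ W.
lemma card_upper_covers [Finite V] [Finite K] {d : ℕ} (W : Submodule K V) (hW : finrank K W = d) :
    #{Z ∈ dimSet K V (d + 1) | W ≤ Z} = qNum (Nat.card K) (finrank K V - d) := by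
  have h3 := Submodule.finrank_quotient_add_finrank W
  have : Finite (V ⧸ W) := Quotient.finite _
  rw [← card_atoms (K := K) (V := V ⧸ W) (by omega),
    ← Nat.card_congr (Equiv.subtypeEquivRight fun Y => mem_dimSet), Nat.card_eq_finsetCard]
  symm
  refine card_bij (fun Y _ => Y.comap W.mkQ) ?_ ?_ ?_
  · intro Y hY
    rw [mem_dimSet] at hY
    simp only [mem_filter, mem_dimSet]
    exact ⟨by rw [finrank_comap_mkQ]; omega, Submodule.le_comap_mkQ W Y⟩
  · intro Y _ Y' _ h
    exact Submodule.comap_injective_of_surjective (Submodule.mkQ_surjective W) h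
  · intro Z hZ
    simp only [mem_filter, mem_dimSet] at hZ
    have hc : (Z.map W.mkQ).comap W.mkQ = Z := by simpa using hZ.2
    refine ⟨Z.map W.mkQ, ?_, hc⟩
    have := finrank_comap_mkQ W (Z.map W.mkQ)
    rw [hc] at this
    rw [mem_dimSet]; omega

lemma finrank_dualAnnihilator [FiniteDimensional K V] (W : Submodule K V) :
    finrank K W.dualAnnihilator = finrank K V - finrank K W := by
  have := Subspace.finrank_add_finrank_dualAnnihilator_eq W
  omega

instance finite_dual [Finite K] [Finite V] : Finite (Dual K V) := Module.finite_of_finite K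

open scoped Classical in
-- Annihilators turn lower covers into upper covers in the dual space.
lemma card_lower_covers [Finite V] [Finite K] {d : ℕ} (Z : Submodule K V)
    (hZ : finrank K Z = d + 1) :
    #{W ∈ dimSet K V d | W ≤ Z} = qNum (Nat.card K) (d + 1) := by
  have h0 := Submodule.finrank_le Z
  have hd := card_upper_covers (d := finrank K V - (d + 1)) Z.dualAnnihilator
    (by rw [finrank_dualAnnihilator, hZ])
  rw [Subspace.dual_finrank_eq, show finrank K V - (finrank K V - (d + 1)) = d + 1 by omega] at hd
  rw [← hd]
  refine card_bij (fun W _ => W.dualAnnihilator) ?_ ?_ ?_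
  · intro W hW
    simp only [mem_filter, mem_dimSet] at hW ⊢
    refine ⟨?_, Submodule.dualAnnihilator_anti hW.2⟩
    rw [finrank_dualAnnihilator, hW.1]; omega
  · intro W _ W' _ h
    exact Subspace.dualAnnihilator_inj.1 h
  · intro Φ hΦ
    simp only [mem_filter, mem_dimSet] at hΦ
    refine ⟨Φ.dualCoannihilator, ?_, Subspace.dualCoannihilator_dualAnnihilator_eq⟩
    have h1 := Subspace.finrank_add_finrank_dualCoannihilator_eq Φ
    simp only [mem_filter, mem_dimSet]
    refine ⟨by omega, ?_⟩
    have := Submodule.dualCoannihilator_anti hΦ.2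
    rwa [Subspace.dualAnnihilator_dualCoannihilator_eq] at this

open scoped Classical in
/-- Two distinct subspaces of the same dimension have as many common covers from above as from
below. -/
lemma card_common_covers [Finite V] {d : ℕ} {W W' : Submodule K V}
    (hW : finrank K W = d + 1) (hW' : finrank K W' = d + 1) (hne : W ≠ W') :
    #{Z ∈ dimSet K V (d + 2) | W ≤ Z ∧ W' ≤ Z} = #{Y ∈ dimSet K V d | Y ≤ W ∧ Y ≤ W'} := by
  have hadd := Submodule.finrank_sup_add_finrank_inf_eq W W'
  have hlt : finrank K ↥(W ⊓ W') < d + 1 := by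
    by_contra hcon
    have e1 := Submodule.eq_of_le_of_finrank_le (inf_le_left : W ⊓ W' ≤ W) (by omega)
    have e2 := Submodule.eq_of_le_of_finrank_le (inf_le_right : W ⊓ W' ≤ W') (by omega)
    exact hne (e1.symm.trans e2)
  -- By the dimension formula the meet has dimension d exactly when the join has dimension d+2. Then
  -- each is the unique common cover on its side; otherwise there are none on either side.
  by_cases h : finrank K ↥(W ⊓ W') = d
  · have e1 : ({Z ∈ dimSet K V (d + 2) | W ≤ Z ∧ W' ≤ Z} : Finset _) = {W ⊔ W'} := by
      ext Z
      simp only [mem_filter, mem_dimSet, mem_singleton]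
      constructor
      · rintro ⟨hZ, h1, h2⟩
        exact (Submodule.eq_of_le_of_finrank_le (sup_le h1 h2) (by omega)).symm
      · rintro rfl
        exact ⟨by omega, le_sup_left, le_sup_right⟩
    have e2 : ({Y ∈ dimSet K V d | Y ≤ W ∧ Y ≤ W'} : Finset _) = {W ⊓ W'} := by
      ext Y
      simp only [mem_filter, mem_dimSet, mem_singleton]
      constructor
      · rintro ⟨hZ, h1, h2⟩
        exact Submodule.eq_of_le_of_finrank_le (le_inf h1 h2) (by omega)
      · rintro rfl
        exact ⟨by omega, inf_le_left, inf_le_right⟩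
    rw [e1, e2, card_singleton, card_singleton]
  · rw [card_eq_zero.2, card_eq_zero.2]
    · rw [filter_eq_empty_iff]
      rintro Y hY ⟨h1, h2⟩
      have := Submodule.finrank_mono (le_inf h1 h2)
      rw [mem_dimSet] at hY; omega
    · rw [filter_eq_empty_iff]
      rintro Z hZ ⟨h1, h2⟩
      have := Submodule.finrank_mono (sup_le h1 h2)
      rw [mem_dimSet] at hZ; omega

end Counting

/-! ### Spectral gap and expander mixing for consecutive levels. -/

section Spectral

variable {K V : Type*} [Field K] [AddCommGroup V] [Module K V] [Finite V]

open scoped Classical in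
/-- The sum of `f` over the `d`-dimensional subspaces of `Z`. -/
noncomputable def sumBelow (d : ℕ) (f : Submodule K V → ℝ) (Z : Submodule K V) : ℝ :=
  ∑ W ∈ dimSet K V d with W ≤ Z, f W

open scoped Classical in
/-- The sum of `f` over the `d`-dimensional subspaces containing `Y`. -/
noncomputable def sumAbove (d : ℕ) (f : Submodule K V → ℝ) (Y : Submodule K V) : ℝ :=
  ∑ W ∈ dimSet K V d with Y ≤ W, f W

/-- The up and down operators are adjoint. -/
lemma sum_mul_sumAbove (c d : ℕ) (f g : Submodule K V → ℝ) :
    ∑ Y ∈ dimSet K V c, g Y * sumAbove d f Y = ∑ W ∈ dimSet K V d, sumBelow c g W * f W := by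
  classical
  simp only [sumAbove, sumBelow, mul_sum, sum_mul, sum_filter]
  rw [sum_comm]
  refine sum_congr rfl fun W _ => sum_congr rfl fun Y _ => ?_
  split_ifs <;> simp

open scoped Classical in
lemma sum_sumBelow_sq (d e : ℕ) (f : Submodule K V → ℝ) :
    ∑ Z ∈ dimSet K V e, sumBelow d f Z ^ 2 =
      ∑ W ∈ dimSet K V d, ∑ W' ∈ dimSet K V d,
        f W * f W' * #{Z ∈ dimSet K V e | W ≤ Z ∧ W' ≤ Z} := by
  simp only [sumBelow, sq, card_filter, Nat.cast_sum, mul_sum, sum_mul, sum_filter]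
  rw [sum_comm]
  refine sum_congr rfl fun W _ => ?_
  rw [sum_comm]
  refine sum_congr rfl fun W' _ => sum_congr rfl fun Z _ => ?_
  split_ifs <;> simp_all [mul_comm]

open scoped Classical in
lemma sum_sumAbove_sq (d e : ℕ) (f : Submodule K V → ℝ) :
    ∑ Y ∈ dimSet K V e, sumAbove d f Y ^ 2 =
      ∑ W ∈ dimSet K V d, ∑ W' ∈ dimSet K V d,
        f W * f W' * #{Y ∈ dimSet K V e | Y ≤ W ∧ Y ≤ W'} := by
  simp only [sumAbove, sq, card_filter, Nat.cast_sum, mul_sum, sum_mul, sum_filter]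
  rw [sum_comm]
  refine sum_congr rfl fun W _ => ?_
  rw [sum_comm]
  refine sum_congr rfl fun W' _ => sum_congr rfl fun Z _ => ?_
  split_ifs <;> simp_all [mul_comm]

variable [Finite K]

lemma sumBelow_const (d : ℕ) {Z : Submodule K V} (hZ : finrank K Z = d + 1) (c : ℝ) :
    sumBelow d (fun _ => c) Z = qNum (Nat.card K) (d + 1) * c := by
  classical
  rw [sumBelow, sum_const, card_lower_covers Z hZ, nsmul_eq_mul]

lemma sumAbove_const (d : ℕ) {Y : Submodule K V} (hY : finrank K Y = d) (c : ℝ) :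
    sumAbove (d + 1) (fun _ => c) Y = qNum (Nat.card K) (finrank K V - d) * c := by
  classical
  rw [sumAbove, sum_const, card_upper_covers Y hY, nsmul_eq_mul]

lemma sum_sumBelow (d : ℕ) (f : Submodule K V → ℝ) :
    ∑ Z ∈ dimSet K V (d + 1), sumBelow d f Z =
      qNum (Nat.card K) (finrank K V - d) * ∑ W ∈ dimSet K V d, f W := by
  have h := sum_mul_sumAbove d (d + 1) (fun _ : Submodule K V => (1 : ℝ)) f
  simp only [mul_one] at h
  rw [← h, mul_sum]
  refine sum_congr rfl fun W hW => ?_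
  rw [sumAbove_const d (mem_dimSet.1 hW), mul_one, mul_comm]

lemma sum_sumAbove (d : ℕ) (f : Submodule K V → ℝ) :
    ∑ Y ∈ dimSet K V d, sumAbove (d + 1) f Y =
      qNum (Nat.card K) (d + 1) * ∑ W ∈ dimSet K V (d + 1), f W := by
  have h := sum_mul_sumAbove d (d + 1) f (fun _ : Submodule K V => (1 : ℝ))
  simp only [one_mul] at h
  rw [h, mul_sum]
  refine sum_congr rfl fun W hW => ?_
  rw [sumBelow_const d (mem_dimSet.1 hW), mul_one]

/-- The commutation relation of the up and down operators, as an identity of quadratic forms. -/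
lemma sum_sumBelow_sq_succ (d : ℕ) (f : Submodule K V → ℝ) :
    ∑ Z ∈ dimSet K V (d + 2), sumBelow (d + 1) f Z ^ 2 =
      ∑ Y ∈ dimSet K V d, sumAbove (d + 1) f Y ^ 2 +
        ((qNum (Nat.card K) (finrank K V - (d + 1)) : ℝ) - qNum (Nat.card K) (d + 1)) *
          ∑ W ∈ dimSet K V (d + 1), f W ^ 2 := by
  classical
  rw [sum_sumBelow_sq, sum_sumAbove_sq, mul_sum, ← sum_add_distrib]
  refine sum_congr rfl fun W hW => ?_
  -- Off-diagonal terms agree by `card_common_covers`; only the diagonal contributes a difference.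
  rw [← add_sum_erase _ _ hW, ← add_sum_erase (dimSet K V (d + 1)) _ hW]
  rw [mem_dimSet] at hW
  simp only [and_self]
  rw [card_upper_covers W hW, card_lower_covers W hW, sum_congr rfl fun W' hW' => by
    rw [card_common_covers hW (mem_dimSet.1 (mem_of_mem_erase hW')) (ne_of_mem_erase hW').symm]]
  ring

/-- The spectral gap of the incidence relation between two consecutive levels. -/
lemma sum_sumBelow_sq_le (d : ℕ) (hd : d + 1 ≤ finrank K V) (f : Submodule K V → ℝ)
    (hf : ∑ W ∈ dimSet K V d, f W = 0) :
    ∑ Z ∈ dimSet K V (d + 1), sumBelow d f Z ^ 2 ≤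
      (Nat.card K * qNum (Nat.card K) d * qNum (Nat.card K) (finrank K V - (d + 1))) *
        ∑ W ∈ dimSet K V d, f W ^ 2 := by
  classical
  induction d generalizing f with
  | zero =>
    have h0 : ∀ Z : Submodule K V, sumBelow 0 f Z = 0 := by
      intro Z
      rw [sumBelow, filter_true_of_mem, hf]
      intro W hW
      rw [mem_dimSet, Submodule.finrank_eq_zero] at hW
      exact hW ▸ bot_le
    simp [h0, qNum_zero]
  | succ d ih =>
    obtain ⟨r, hr⟩ := Nat.exists_eq_add_of_le hd
    rw [sum_sumBelow_sq_succ]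
    set q := Nat.card K
    set g := sumAbove (d + 1) f with hg
    set S := ∑ Y ∈ dimSet K V d, g Y ^ 2
    set N := ∑ W ∈ dimSet K V (d + 1), f W ^ 2
    have hgs : ∑ Y ∈ dimSet K V d, g Y = 0 := by rw [hg, sum_sumAbove, hf, mul_zero]
    have h1 := ih (by omega) g hgs
    have h2 : S = ∑ W ∈ dimSet K V (d + 1), sumBelow d g W * f W := by
      rw [← sum_mul_sumAbove]
      exact sum_congr rfl fun Y _ => sq _
    have h3 := sum_mul_sq_le_sq_mul_sq (dimSet K V (d + 1)) (sumBelow d g) f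
    rw [← h2] at h3
    have hN : 0 ≤ N := sum_nonneg fun _ _ => sq_nonneg _
    have hS0 : 0 ≤ S := sum_nonneg fun _ _ => sq_nonneg _
    have h4 := h3.trans (mul_le_mul_of_nonneg_right h1 hN)
    -- An operator and its adjoint have the same norm: Cauchy–Schwarz gives S² ≤ λSN, with λ the
    -- bound one level lower, and S cancels.
    have hS : S ≤ q * qNum q d * qNum q (finrank K V - (d + 1)) * N := by
      rcases hS0.eq_or_lt with h | h
      · rw [← h]; positivity
      · refine le_of_mul_le_mul_left ?_ h
        calc S * S = S ^ 2 := (sq S).symm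
          _ ≤ _ := h4
          _ = _ := by ring
    rw [show finrank K V - (d + 1) = r + 1 by omega] at hS ⊢
    rw [show finrank K V - (d + 1 + 1) = r by omega]
    rw [qNum_succ q r] at hS ⊢
    rw [qNum_succ q d]
    push_cast at hS ⊢
    -- The induction closes by q[d][r+1] + [r+1] - [d+1] = q[d+1][r].
    linarith [hS]

open scoped Classical in
lemma sum_centered_indicator {α : Type*} {T L : Finset α} (h : T ⊆ L) :
    ∑ x ∈ L, ((#L : ℝ) * (if x ∈ T then 1 else 0) - #T) = 0 := by
  simp only [sum_sub_distrib, ← mul_sum, sum_ite_mem, inter_eq_right.2 h, sum_const, nsmul_eq_mul]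
  ring

open scoped Classical in
lemma sum_centered_indicator_sq {α : Type*} {T L : Finset α} (h : T ⊆ L) :
    ∑ x ∈ L, ((#L : ℝ) * (if x ∈ T then 1 else 0) - (#T : ℝ)) ^ 2 = (#L : ℝ) * #T * (#L - #T) := by
  have e : ∀ x ∈ L, ((#L : ℝ) * (if x ∈ T then 1 else 0) - (#T : ℝ)) ^ 2 =
      ((#L : ℝ) ^ 2 - 2 * #L * #T) * (if x ∈ T then 1 else 0) + (#T : ℝ) ^ 2 := by
    intro x _
    split_ifs <;> ring
  rw [sum_congr rfl e]
  simp only [sum_add_distrib, ← mul_sum, sum_ite_mem, inter_eq_right.2 h, sum_const, nsmul_eq_mul]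
  ring

open scoped Classical in
/-- The expander mixing lemma for two consecutive levels, in the case where the two families
together have at least as many members as a level. -/
lemma card_incidences_ge {m : ℕ} (hm : finrank K V = 2 * m + 1) {A B : Finset (Submodule K V)}
    {N : ℕ} (hA : A ⊆ dimSet K V m) (hB : B ⊆ dimSet K V (m + 1)) (hN : #(dimSet K V m) = N)
    (hN' : #(dimSet K V (m + 1)) = N) (hAB : N ≤ #A + #B) :
    ((qNum (Nat.card K) (m + 1) : ℝ) - √(Nat.card K) * qNum (Nat.card K) m) * (#A * #B) ≤
      N * ∑ Z ∈ B, (#{W ∈ A | W ≤ Z} : ℝ) := by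
  set q := Nat.card K
  set E := ∑ Z ∈ B, (#{W ∈ A | W ≤ Z} : ℝ)
  have hαN : #A ≤ N := hN ▸ card_le_card hA
  have hβN : #B ≤ N := hN' ▸ card_le_card hB
  rcases N.eq_zero_or_pos with h0 | hpos
  · have : #A = 0 := by omega
    simp [this, h0]
  -- Indicators scaled by N and centred to have sum zero, as the spectral bound requires of `u`.
  set u : Submodule K V → ℝ := fun W => (N : ℝ) * (if W ∈ A then 1 else 0) - #A
  set v : Submodule K V → ℝ := fun Z => (N : ℝ) * (if Z ∈ B then 1 else 0) - #B
  have hu0 : ∑ W ∈ dimSet K V m, u W = 0 := by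
    simpa [u, hN] using sum_centered_indicator hA
  have hu2 : ∑ W ∈ dimSet K V m, u W ^ 2 = N * #A * (N - #A) := by
    have h := sum_centered_indicator_sq hA
    rw [hN] at h
    convert h
  have hv2 : ∑ Z ∈ dimSet K V (m + 1), v Z ^ 2 = N * #B * (N - #B) := by
    have h := sum_centered_indicator_sq hB
    rw [hN'] at h
    convert h
  have hUu : ∀ Z ∈ dimSet K V (m + 1),
      sumBelow m u Z = N * #{W ∈ A | W ≤ Z} - qNum q (m + 1) * #A := by
    intro Z hZ
    rw [← sumBelow_const m (mem_dimSet.1 hZ)]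
    simp only [sumBelow, u, sum_sub_distrib, ← mul_sum, card_filter, Nat.cast_sum, sum_filter]
    congr 2
    rw [← sum_subset hA]
    · exact sum_congr rfl fun W hW => by simp [hW]
    · intro W _ hW
      simp [hW]
  have hUu0 : ∑ Z ∈ dimSet K V (m + 1), sumBelow m u Z = 0 := by
    rw [sum_sumBelow, hu0, mul_zero]
  have hvu : ∑ Z ∈ dimSet K V (m + 1), v Z * sumBelow m u Z =
      N * (N * E - qNum q (m + 1) * (#A * #B)) := by
    have e1 : ∀ Z ∈ dimSet K V (m + 1), v Z * sumBelow m u Z =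
        N * (if Z ∈ B then sumBelow m u Z else 0) - #B * sumBelow m u Z := by
      intro Z _
      simp only [v]
      split_ifs <;> ring
    rw [sum_congr rfl e1, sum_sub_distrib, ← mul_sum, ← mul_sum, hUu0, sum_ite_mem,
      inter_eq_right.2 hB, sum_congr rfl fun Z hZ => hUu Z (hB hZ), sum_sub_distrib, ← mul_sum,
      sum_const, nsmul_eq_mul]
    ring
  have hcs := sum_mul_sq_le_sq_mul_sq (dimSet K V (m + 1)) v (sumBelow m u)
  have hsp := sum_sumBelow_sq_le m (by omega) u hu0
  rw [hu2, show finrank K V - (m + 1) = m by omega] at hsp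
  rw [hvu, hv2] at hcs
  have hα : (0 : ℝ) ≤ N - #A := by
    rw [sub_nonneg]; exact_mod_cast hαN
  have hβ : (0 : ℝ) ≤ N - #B := by
    rw [sub_nonneg]; exact_mod_cast hβN
  have hAB' : (N : ℝ) ≤ #A + #B := by exact_mod_cast hAB
  have hNR : (0 : ℝ) < N := by exact_mod_cast hpos
  have hsq : (N * E - qNum q (m + 1) * (#A * #B)) ^ 2 ≤ (√q * qNum q m * (#A * #B)) ^ 2 := by
    -- Here |A|+|B| ≥ N makes the mixing error a multiple of |A||B| itself.
    have h1 : ((N : ℝ) - #B) * (N - #A) ≤ #A * #B :=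
      mul_le_mul (by linarith) (by linarith) hα (by positivity)
    have h2 : ((N : ℝ) * (N * E - qNum q (m + 1) * (#A * #B))) ^ 2 ≤
        N ^ 2 * (√q * qNum q m * (#A * #B)) ^ 2 := by
      calc _ ≤ _ := hcs
        _ ≤ N * #B * (N - #B) * (q * qNum q m * qNum q m * (N * #A * (N - #A))) :=
          mul_le_mul_of_nonneg_left hsp (by positivity)
        _ = (N ^ 2 * (q * qNum q m * qNum q m) * (#A * #B)) * ((N - #B) * (N - #A)) := by ring
        _ ≤ (N ^ 2 * (q * qNum q m * qNum q m) * (#A * #B)) * (#A * #B) :=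
          mul_le_mul_of_nonneg_left h1 (by positivity)
        _ = N ^ 2 * ((√q) ^ 2 * qNum q m ^ 2 * (#A * #B) ^ 2) := by
          rw [Real.sq_sqrt (by positivity)]; ring
        _ = _ := by ring
    rw [mul_pow] at h2
    exact le_of_mul_le_mul_left h2 (by positivity)
  have := (abs_le.1 (abs_le_of_sq_le_sq hsq (by positivity))).1
  linarith

end Spectral

/-! ### Hall's theorem and shadows in the middle levels. -/

lemma qNum_mono {q i j : ℕ} (h : i ≤ j) : qNum q i ≤ qNum q j :=
  sum_le_sum_of_subset (range_subset_range.2 h)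

lemma qNum_succ_add_le (q d : ℕ) : qNum q (d + 1) + q ≤ qNum q (d + 2) := by
  rw [qNum, qNum, sum_range_succ _ (d + 1)]
  exact Nat.add_le_add_left (Nat.le_self_pow (by omega) q) _

open scoped Classical in
/-- Hall's marriage theorem for a relation between two finite subsets of a type. -/
lemma exists_injOn_of_card_le {α : Type*} (r : α → α → Prop) (S L : Finset α)
    (h : ∀ T ⊆ S, #T ≤ #{b ∈ L | ∃ a ∈ T, r a b}) :
    ∃ g : α → α, Set.InjOn g S ∧ ∀ a ∈ S, g a ∈ L ∧ r a (g a) := by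
  obtain ⟨f, hf, hfr⟩ := (all_card_le_biUnion_card_iff_exists_injective
    (fun a : S => ({b ∈ L | r a b} : Finset α))).1 (by
      intro T
      refine (card_map (Function.Embedding.subtype _)).symm.le.trans
        ((h (T.map (Function.Embedding.subtype _)) ?_).trans (card_le_card ?_))
      · intro a ha
        obtain ⟨b, _, rfl⟩ := mem_map.1 ha
        exact b.2
      · intro b hb
        obtain ⟨hbL, a, ha, hab⟩ := mem_filter.1 hb
        obtain ⟨a', ha', rfl⟩ := mem_map.1 ha
        exact mem_biUnion.2 ⟨a', ha', mem_filter.2 ⟨hbL, hab⟩⟩)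
  have hm : ∀ a (ha : a ∈ S), f ⟨a, ha⟩ ∈ L ∧ r a (f ⟨a, ha⟩) := fun a ha =>
    mem_filter.1 (hfr ⟨a, ha⟩)
  refine ⟨fun a => if ha : a ∈ S then f ⟨a, ha⟩ else a, ?_, ?_⟩
  · intro a ha b hb hab
    rw [mem_coe] at ha hb
    simp only [dif_pos ha, dif_pos hb] at hab
    exact congrArg Subtype.val (hf hab)
  · intro a ha
    simp only [dif_pos ha]
    exact hm a ha

section Shadow

variable {K V : Type*} [Field K] [AddCommGroup V] [Module K V]

open scoped Classical in
/-- Above each member of `S` there are at most `c` members of `S` of each larger dimension. -/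
def FewAbove (c : ℕ) (S : Finset (Submodule K V)) : Prop :=
  ∀ x ∈ S, ∀ j, finrank K x < j → #{y ∈ S | x ≤ y ∧ finrank K y = j} ≤ c

open scoped Classical in
/-- Below each member of `S` there are at most `c` members of `S` of each smaller dimension. -/
def FewBelow (c : ℕ) (S : Finset (Submodule K V)) : Prop :=
  ∀ x ∈ S, ∀ j, j < finrank K x → #{y ∈ S | y ≤ x ∧ finrank K y = j} ≤ c

lemma FewAbove.mono {c : ℕ} {S T : Finset (Submodule K V)} (h : FewAbove c S) (hT : T ⊆ S) :
    FewAbove c T := fun x hx j hj => by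
  classical exact (card_le_card (filter_subset_filter _ hT)).trans (h x (hT hx) j hj)

lemma FewBelow.mono {c : ℕ} {S T : Finset (Submodule K V)} (h : FewBelow c S) (hT : T ⊆ S) :
    FewBelow c T := fun x hx j hj => by
  classical exact (card_le_card (filter_subset_filter _ hT)).trans (h x (hT hx) j hj)

lemma dualAnnihilator_le_iff {W W' : Submodule K V} :
    W.dualAnnihilator ≤ W'.dualAnnihilator ↔ W' ≤ W :=
  Subspace.dualAnnihilator_le_dualAnnihilator_iff

variable [Finite V]

open scoped Classical in
lemma FewBelow.dual {c : ℕ} {S : Finset (Submodule K V)} (hS : FewBelow c S) :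
    FewAbove c (S.image Submodule.dualAnnihilator) := by
  intro Φ hΦ j hj
  obtain ⟨x, hx, rfl⟩ := mem_image.1 hΦ
  rw [finrank_dualAnnihilator] at hj
  -- Beyond dim V the truncated difference dim V - j would be 0, so this range is treated apart.
  by_cases hjn : finrank K V < j
  · rw [filter_eq_empty_iff.2, card_empty]
    · exact Nat.zero_le _
    · rintro Ψ - ⟨-, h⟩
      have := Submodule.finrank_le Ψ
      rw [Subspace.dual_finrank_eq] at this
      omega
  have hxn := Submodule.finrank_le x
  rw [filter_image, card_image_of_injective _ fun _ _ => Subspace.dualAnnihilator_inj.1]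
  refine (card_le_card ?_).trans (hS x hx (finrank K V - j) (by omega))
  intro y hy
  obtain ⟨hy, hle, hd⟩ := mem_filter.1 hy
  have := Submodule.finrank_le y
  rw [finrank_dualAnnihilator] at hd
  exact mem_filter.2 ⟨hy, dualAnnihilator_le_iff.1 hle, by omega⟩

variable [Finite K]

open scoped Classical in
-- Induction on the depth j of the family below level m: its lowest layer is replaced by the upper
-- covers not already present. This strictly enlarges the family and adds nothing to its shadow in
-- level m.
lemma card_le_card_upperShadow_aux {c m : ℕ} (hc : c < Nat.card K)
    (hm : 2 * m + 1 ≤ finrank K V) (j : ℕ) (S : Finset (Submodule K V)) (hS : FewAbove c S)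
    (hSm : ∀ x ∈ S, finrank K x ≤ m) (hSj : ∀ x ∈ S, m ≤ finrank K x + j) :
    #S ≤ #{a ∈ dimSet K V m | ∃ x ∈ S, x ≤ a} ∧
      ((∃ x ∈ S, finrank K x < m) → #S < #{a ∈ dimSet K V m | ∃ x ∈ S, x ≤ a}) := by
  induction j generalizing S with
  | zero =>
    have hd : ∀ x ∈ S, finrank K x = m := fun x hx =>
      le_antisymm (hSm x hx) (by simpa using hSj x hx)
    refine ⟨card_le_card fun x hx => ?_, ?_⟩
    · simp only [mem_filter, mem_dimSet]
      exact ⟨hd x hx, x, hx, le_rfl⟩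
    · rintro ⟨x, hx, h⟩
      exact absurd (hd x hx) h.ne
  | succ j ih =>
    by_cases hT : ∀ x ∈ S, m ≤ finrank K x + j
    · exact ih S hS hSm hT
    suffices h : #S < #{a ∈ dimSet K V m | ∃ x ∈ S, x ≤ a} from ⟨h.le, fun _ => h⟩
    push Not at hT
    obtain ⟨x₀, hx₀, hx₀'⟩ := hT
    obtain ⟨d, hd⟩ : ∃ d, d + (j + 1) = m := ⟨finrank K x₀, by have := hSj x₀ hx₀; omega⟩
    set T : Finset (Submodule K V) := {x ∈ S | finrank K x = d} with hT
    set T' : Finset (Submodule K V) := {z ∈ dimSet K V (d + 1) | (∃ x ∈ T, x ≤ z) ∧ z ∉ S} with hT'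
    have hTS : T ⊆ S := filter_subset _ _
    have hTne : 0 < #T := card_pos.2 ⟨x₀, mem_filter.2 ⟨hx₀, by have := hSj x₀ hx₀; omega⟩⟩
    have hdisj : Disjoint (S \ T) T' := by
      rw [disjoint_left]
      intro z hz hz'
      exact (mem_filter.1 hz').2.2 (mem_sdiff.1 hz).1
    have hlow : ∀ x ∈ S \ T ∪ T', d + 1 ≤ finrank K x ∧ ∃ x' ∈ S, x' ≤ x := by
      intro x hx
      rcases mem_union.1 hx with h | h
      · obtain ⟨h1, h2⟩ := mem_sdiff.1 h
        have := hSj x h1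
        have : finrank K x ≠ d := fun h => h2 (mem_filter.2 ⟨h1, h⟩)
        exact ⟨by omega, x, h1, le_rfl⟩
      · obtain ⟨h1, ⟨x', hx', hle⟩, -⟩ := mem_filter.1 h
        exact ⟨(mem_dimSet.1 h1).ge, x', hTS hx', hle⟩
    have hlt : #T < #T' := by
      -- Double counting: a member of T has at least [d+2] ≥ [d+1]+q covers, of which at most c < q
      -- lie in S, while a member of T' has only [d+1] lower covers.
      have h1 := card_mul_le_card_mul (s := T) (t := T') (· ≤ ·)
        (m := qNum (Nat.card K) (d + 1) + 1) (n := qNum (Nat.card K) (d + 1)) ?_ ?_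
      · by_contra hcon
        have := Nat.mul_le_mul_right (qNum (Nat.card K) (d + 1)) (not_lt.1 hcon)
        rw [mul_add] at h1
        omega
      · intro x hx
        obtain ⟨hxS, hxd⟩ := mem_filter.1 hx
        have h1 := card_upper_covers x hxd
        have h2 := hS x hxS (d + 1) (by omega)
        have h3 := qNum_succ_add_le (Nat.card K) d
        have h4 := qNum_mono (q := Nat.card K) (show d + 2 ≤ finrank K V - d by omega)
        have h5 : ({Z ∈ dimSet K V (d + 1) | x ≤ Z} : Finset _) ⊆
            T'.bipartiteAbove (· ≤ ·) x ∪ {y ∈ S | x ≤ y ∧ finrank K y = d + 1} := by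
          intro z hz
          obtain ⟨hz, hxz⟩ := mem_filter.1 hz
          by_cases hzS : z ∈ S
          · exact mem_union_right _ (mem_filter.2 ⟨hzS, hxz, mem_dimSet.1 hz⟩)
          · exact mem_union_left _ (mem_filter.2 ⟨mem_filter.2 ⟨hz, ⟨x, hx, hxz⟩, hzS⟩, hxz⟩)
        have h6 := (card_le_card h5).trans (card_union_le _ _)
        omega
      · intro z hz
        rw [← card_lower_covers z (mem_dimSet.1 (mem_filter.1 hz).1)]
        refine card_le_card fun x hx => ?_
        obtain ⟨hxT, hxz⟩ := mem_filter.1 hx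
        exact mem_filter.2 ⟨mem_dimSet.2 (mem_filter.1 hxT).2, hxz⟩
    -- The new members have the least dimension d+1, so whatever lies in a larger dimension above x
    -- is old and lies above an old x' ≤ x.
    have hFew : FewAbove c (S \ T ∪ T') := by
      intro x hx i hi
      obtain ⟨hdx, x', hx', hle⟩ := hlow x hx
      refine (card_le_card ?_).trans (hS x' hx' i ((Submodule.finrank_mono hle).trans_lt hi))
      intro y hy
      obtain ⟨hy, hxy, hyi⟩ := mem_filter.1 hy
      refine mem_filter.2 ⟨?_, hle.trans hxy, hyi⟩
      rcases mem_union.1 hy with h | h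
      · exact (mem_sdiff.1 h).1
      · have := mem_dimSet.1 (mem_filter.1 h).1
        omega
    have key := (ih (S \ T ∪ T') hFew ?_ ?_).1
    · calc #S = #(S \ T) + #T := (card_sdiff_add_card_eq_card hTS).symm
        _ < #(S \ T) + #T' := by omega
        _ = #(S \ T ∪ T') := (card_union_of_disjoint hdisj).symm
        _ ≤ _ := key
        _ ≤ _ := card_le_card fun a ha => by
          obtain ⟨ha, x, hx, hxa⟩ := mem_filter.1 ha
          obtain ⟨-, x', hx', hle⟩ := hlow x hx
          exact mem_filter.2 ⟨ha, x', hx', hle.trans hxa⟩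
    · intro x hx
      rcases mem_union.1 hx with h | h
      · exact hSm x (mem_sdiff.1 h).1
      · have := mem_dimSet.1 (mem_filter.1 h).1
        omega
    · intro x hx
      have := (hlow x hx).1
      omega

open scoped Classical in
lemma card_le_card_upperShadow {c m : ℕ} (hc : c < Nat.card K) (hm : 2 * m + 1 ≤ finrank K V)
    {S : Finset (Submodule K V)} (hS : FewAbove c S) (hSm : ∀ x ∈ S, finrank K x ≤ m) :
    #S ≤ #{a ∈ dimSet K V m | ∃ x ∈ S, x ≤ a} :=
  (card_le_card_upperShadow_aux hc hm m S hS hSm fun _ _ => Nat.le_add_left _ _).1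

lemma card_lt_card_dimSet_of_exists_lt {c m : ℕ} (hc : c < Nat.card K)
    (hm : 2 * m + 1 ≤ finrank K V) {S : Finset (Submodule K V)} (hS : FewAbove c S)
    (hSm : ∀ x ∈ S, finrank K x ≤ m) (h : ∃ x ∈ S, finrank K x < m) :
    #S < #(dimSet K V m) := by
  classical
  exact ((card_le_card_upperShadow_aux hc hm m S hS hSm fun _ _ => Nat.le_add_left _ _).2 h).trans_le
    (card_le_card (filter_subset _ _))

lemma mem_dimSet_dualAnnihilator {d e : ℕ} (h : d + e = finrank K V) {W : Submodule K V} :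
    W.dualAnnihilator ∈ dimSet K (Dual K V) d ↔ W ∈ dimSet K V e := by
  have := Submodule.finrank_le W
  rw [mem_dimSet, mem_dimSet, finrank_dualAnnihilator]
  omega

lemma card_dimSet_dual {d e : ℕ} (h : d + e = finrank K V) :
    #(dimSet K (Dual K V) d) = #(dimSet K V e) := by
  classical
  have : dimSet K (Dual K V) d = (dimSet K V e).image Submodule.dualAnnihilator := by
    ext Φ
    obtain ⟨W, rfl⟩ : ∃ W : Submodule K V, W.dualAnnihilator = Φ :=
      ⟨_, Subspace.dualCoannihilator_dualAnnihilator_eq⟩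
    rw [mem_dimSet_dualAnnihilator h,
      Function.Injective.mem_finset_image fun _ _ => Subspace.dualAnnihilator_inj.1]
  rw [this, card_image_of_injective _ fun _ _ => Subspace.dualAnnihilator_inj.1]

open scoped Classical in
lemma card_le_card_lowerShadow {c m e : ℕ} (hc : c < Nat.card K) (hme : m + e = finrank K V)
    (hm : m < e) {S : Finset (Submodule K V)} (hS : FewBelow c S)
    (hSm : ∀ x ∈ S, e ≤ finrank K x) :
    #S ≤ #{a ∈ dimSet K V e | ∃ x ∈ S, a ≤ x} := by
  have h := card_le_card_upperShadow (m := m) hc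
    (by rw [Subspace.dual_finrank_eq]; omega) hS.dual ?_
  · rw [card_image_of_injective _ fun _ _ => Subspace.dualAnnihilator_inj.1] at h
    refine h.trans ?_
    rw [← card_image_of_injective ({a ∈ dimSet K V e | ∃ x ∈ S, a ≤ x} : Finset _)
      (f := Submodule.dualAnnihilator) fun _ _ => Subspace.dualAnnihilator_inj.1]
    refine card_le_card fun Φ hΦ => ?_
    obtain ⟨W, rfl⟩ : ∃ W : Submodule K V, W.dualAnnihilator = Φ :=
      ⟨_, Subspace.dualCoannihilator_dualAnnihilator_eq⟩
    obtain ⟨h1, _, hx', hle⟩ := mem_filter.1 hΦ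
    obtain ⟨x, hx, rfl⟩ := mem_image.1 hx'
    exact mem_image_of_mem _ (mem_filter.2
      ⟨(mem_dimSet_dualAnnihilator hme).1 h1, x, hx, dualAnnihilator_le_iff.1 hle⟩)
  · intro Φ hΦ
    obtain ⟨x, hx, rfl⟩ := mem_image.1 hΦ
    have := hSm x hx
    rw [finrank_dualAnnihilator]
    omega

lemma card_lt_card_dimSet_of_exists_gt {c m e : ℕ} (hc : c < Nat.card K)
    (hme : m + e = finrank K V) (hm : m < e) {S : Finset (Submodule K V)} (hS : FewBelow c S)
    (hSm : ∀ x ∈ S, e ≤ finrank K x) (h : ∃ x ∈ S, e < finrank K x) :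
    #S < #(dimSet K V e) := by
  classical
  have h := card_lt_card_dimSet_of_exists_lt (m := m) hc
    (by rw [Subspace.dual_finrank_eq]; omega) hS.dual ?_ ?_
  · rwa [card_image_of_injective _ fun _ _ => Subspace.dualAnnihilator_inj.1,
      card_dimSet_dual hme] at h
  · intro Φ hΦ
    obtain ⟨x, hx, rfl⟩ := mem_image.1 hΦ
    have := hSm x hx
    rw [finrank_dualAnnihilator]
    omega
  · obtain ⟨x, hx, hlt⟩ := h
    have := Submodule.finrank_le x
    refine ⟨_, mem_image_of_mem _ hx, ?_⟩
    rw [finrank_dualAnnihilator]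
    omega

end Shadow

/-! ### Level sizes as Gaussian binomials. -/

section Count

variable {K V : Type*} [Field K] [AddCommGroup V] [Module K V] [Finite V] [Finite K]

lemma card_dimSet_succ_mul (d : ℕ) :
    #(dimSet K V (d + 1)) * qNum (Nat.card K) (d + 1) =
      #(dimSet K V d) * qNum (Nat.card K) (finrank K V - d) := by
  have h := sum_sumBelow (K := K) (V := V) d (fun _ => 1)
  rw [sum_congr rfl fun Z hZ => sumBelow_const d (mem_dimSet.1 hZ) 1, sum_const, sum_const,
    nsmul_eq_mul, nsmul_eq_mul, mul_one, mul_one] at h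
  rw [mul_comm #(dimSet K V d)]
  exact_mod_cast h

lemma qNum_pos (q : ℕ) {j : ℕ} (hj : 0 < j) : 0 < qNum q j := by
  obtain ⟨j, rfl⟩ := Nat.exists_eq_succ_of_ne_zero hj.ne'
  rw [Nat.succ_eq_add_one, qNum_succ]
  omega

lemma sub_one_mul_qNum (q j : ℕ) : ((q : ℚ) - 1) * qNum q j = (q : ℚ) ^ j - 1 := by
  rw [qNum]
  push_cast
  exact mul_geom_sum _ _

lemma card_dimSet_eq_qBinom (d : ℕ) (hd : d ≤ finrank K V) :
    (#(dimSet K V d) : ℚ) = qBinom (Nat.card K) (finrank K V) d := by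
  have hq : (1 : ℚ) < Nat.card K := by exact_mod_cast Finite.one_lt_card (α := K)
  induction d with
  | zero =>
    have : dimSet K V 0 = {⊥} := by
      ext W
      rw [mem_dimSet, Submodule.finrank_eq_zero, mem_singleton]
    rw [this, qBinom]
    simp
  | succ d ih =>
    have ih := ih (by omega)
    have h : (#(dimSet K V (d + 1)) : ℚ) * qNum (Nat.card K) (d + 1) =
      #(dimSet K V d) * qNum (Nat.card K) (finrank K V - d) := by
        exact_mod_cast card_dimSet_succ_mul (K := K) (V := V) d
    have hne : (Nat.card K : ℚ) ^ (d + 1) - 1 ≠ 0 :=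
      (sub_pos.2 (one_lt_pow₀ hq (by omega))).ne'
    have hB : qBinom (Nat.card K) (finrank K V) (d + 1) =
        qBinom (Nat.card K) (finrank K V) d * ((Nat.card K : ℚ) ^ (finrank K V - d) - 1) /
          ((Nat.card K : ℚ) ^ (d + 1) - 1) := by
      -- The numerator gains its last factor, i = d, whereas the denominator gains its first, i = 0,
      -- the other factors being shifted.
      simp only [qBinom, prod_div_distrib]
      rw [prod_range_succ, prod_range_succ' (fun i => (Nat.card K : ℚ) ^ (d + 1 - i) - 1)]
      simp only [Nat.add_sub_add_right, Nat.sub_zero]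
      rw [mul_div_mul_comm, mul_div_assoc]
    rw [hB, ← ih, eq_div_iff hne, ← sub_one_mul_qNum, ← sub_one_mul_qNum]
    linear_combination ((Nat.card K : ℚ) - 1) * h

lemma card_dimSet_middle {m : ℕ} (hV : finrank K V = 2 * m + 1) :
    #(dimSet K V (m + 1)) = #(dimSet K V m) := by
  have h := card_dimSet_succ_mul (K := K) (V := V) m
  rw [show finrank K V - m = m + 1 by omega] at h
  exact Nat.eq_of_mul_eq_mul_right (qNum_pos _ (by omega)) h

end Count

/-! ### From forbidden posets to comparability counts. -/

section Embedding

lemma exists_vPoset_embedding {α : Type*} [PartialOrder α] {k : ℕ} (a : α) (f : Fin k → α)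
    (ha : ∀ i, a < f i) (hf : ∀ i j, f i ≤ f j → i = j) : Nonempty (VPoset k ↪o α) := by
  refine ⟨OrderEmbedding.ofMapLEIff
    (fun p => VPoset.casesOn (motive := fun _ => α) p a f) ?_⟩
  rintro (_ | i) (_ | j)
  · exact ⟨fun _ => le_rfl, fun _ => le_rfl⟩
  · exact ⟨fun _ => Or.inl rfl, fun _ => (ha j).le⟩
  · refine ⟨fun h => absurd h (ha i).not_ge, ?_⟩
    rintro (h | h) <;> cases h
  · refine ⟨fun h => hf i j h ▸ le_rfl, ?_⟩
    rintro (h | h) <;> cases h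
    exact le_rfl

lemma VPoset.y_lt_x {k : ℕ} (i : Fin k) : (VPoset.y : VPoset k) < VPoset.x i := by
  refine lt_of_le_of_ne (Or.inl rfl) ?_
  intro h
  cases h

variable {K V : Type*} [Field K] [AddCommGroup V] [Module K V]

/-- Members of equal dimension form an antichain, so c+1 of them above x give an induced copy. -/
lemma InducedFree.fewAbove [FiniteDimensional K V] {Ps : Set FinPartOrd.{0}}
    {F : Finset (Submodule K V)}
    (h : InducedFree Ps F) {c : ℕ} (hc : FinPartOrd.of (VPoset (c + 1)) ∈ Ps) : FewAbove c F := by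
  classical
  intro x hx j hj
  by_contra! hcon
  set S : Finset (Submodule K V) := {y ∈ F | x ≤ y ∧ finrank K y = j}
  obtain ⟨f⟩ : Nonempty (Fin (c + 1) ↪ S) :=
    Function.Embedding.nonempty_of_card_le (by simpa using hcon)
  have hfm : ∀ i, (f i).1 ∈ F ∧ x ≤ (f i).1 ∧ finrank K (f i).1 = j := fun i =>
    mem_filter.1 (f i).2
  obtain ⟨e⟩ := exists_vPoset_embedding (⟨x, hx⟩ : {W // W ∈ F})
    (fun i => ⟨(f i).1, (hfm i).1⟩)
    (fun i => by
      refine lt_of_le_of_ne (hfm i).2.1 fun he => ?_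
      have h1 := (hfm i).2.2
      rw [← congrArg Subtype.val he] at h1
      exact hj.ne h1)
    (fun i i' hle => f.injective (Subtype.ext (Submodule.eq_of_le_of_finrank_eq hle
      ((hfm i).2.2.trans (hfm i').2.2.symm))))
  exact (h _ hc).false e

lemma InducedFree.fewBelow [FiniteDimensional K V] {Ps : Set FinPartOrd.{0}}
    {F : Finset (Submodule K V)}
    (h : InducedFree Ps F) {c : ℕ} (hc : FinPartOrd.of (LambdaPoset (c + 1)) ∈ Ps) :
    FewBelow c F := by
  classical
  intro x hx j hj
  by_contra! hcon
  set S : Finset (Submodule K V) := {y ∈ F | y ≤ x ∧ finrank K y = j}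
  obtain ⟨f⟩ : Nonempty (Fin (c + 1) ↪ S) :=
    Function.Embedding.nonempty_of_card_le (by simpa using hcon)
  have hfm : ∀ i, (f i).1 ∈ F ∧ (f i).1 ≤ x ∧ finrank K (f i).1 = j := fun i =>
    mem_filter.1 (f i).2
  obtain ⟨e⟩ := exists_vPoset_embedding (α := {W // W ∈ F}ᵒᵈ) (OrderDual.toDual ⟨x, hx⟩)
    (fun i => OrderDual.toDual ⟨(f i).1, (hfm i).1⟩)
    (fun i => by
      refine lt_of_le_of_ne (hfm i).2.1 fun he => ?_
      have h1 := (hfm i).2.2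
      rw [← Subtype.ext_iff.1 (OrderDual.toDual.injective he)] at h1
      exact hj.ne' h1)
    (fun i i' hle => f.injective (Subtype.ext (Submodule.eq_of_le_of_finrank_eq hle
      ((hfm i').2.2.trans (hfm i).2.2.symm)).symm))
  exact (h _ hc).false e.dual

lemma inducedFree_dimSet [Finite V] {k l : ℕ} (hk : 1 ≤ k) (hl : 1 ≤ l) (d : ℕ) :
    InducedFree {FinPartOrd.of (VPoset k), FinPartOrd.of (LambdaPoset l)} (dimSet K V d) := by
  have key : ∀ W W' : {W : Submodule K V // W ∈ dimSet K V d}, ¬ W < W' := fun W W' hlt => by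
    have := Submodule.finrank_lt_finrank_of_lt (show W.1 < W'.1 from hlt)
    rw [mem_dimSet.1 W.2, mem_dimSet.1 W'.2] at this
    exact this.false
  rintro P (rfl | rfl)
  · exact ⟨fun e => key _ _ (e.lt_iff_lt.2 (VPoset.y_lt_x ⟨0, hk⟩))⟩
  · have hlt : (OrderDual.toDual (VPoset.x ⟨0, hl⟩) : LambdaPoset l) < OrderDual.toDual VPoset.y :=
      VPoset.y_lt_x ⟨0, hl⟩
    exact ⟨fun e => key _ _ (e.lt_iff_lt.2 hlt)⟩

end Embedding

/-! ### Incidences against the gap, and the extremal bound. -/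

/-- The incidence bound of `V_k`- and `Λ_l`-free families lies below the spectral gap. -/
lemma incidence_bound_lt_gap {q m c c' : ℕ} (hm : 1 ≤ m)
    (hc : ((c + 1 : ℕ) : ℝ) ≤ (1 - √2 / 2) * q) (hc' : ((c' + 1 : ℕ) : ℝ) ≤ (1 - √2 / 2) * q) :
    (c * m + 1 : ℝ) + (c' * m + 1) < qNum q (m + 1) - √q * qNum q m := by
  have h2 : (1.41 : ℝ) < √2 := Real.lt_sqrt_of_sq_lt (by norm_num)
  have hq0 : (0 : ℝ) ≤ q := Nat.cast_nonneg q
  have hb : (1 - √2 / 2) * (q : ℝ) ≤ 0.295 * q := mul_le_mul_of_nonneg_right (by linarith) hq0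
  push_cast at hc hc'
  have hc0 : (0 : ℝ) ≤ c := Nat.cast_nonneg c
  -- 1 ≤ c+1 ≤ 0.295q forces q > 3.
  have hq4 : 4 ≤ q := by
    have : (3 : ℝ) < q := by linarith
    exact_mod_cast this
  have hq4R : (4 : ℝ) ≤ q := by exact_mod_cast hq4
  set s := √(q : ℝ)
  have hs0 : 0 ≤ s := Real.sqrt_nonneg _
  have hss : s * s = q := Real.mul_self_sqrt hq0
  have hs2 : 2 ≤ s := by nlinarith
  rw [qNum_succ]
  push_cast
  rcases hm.eq_or_lt with rfl | hm2
  · rw [qNum_succ, qNum_zero]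
    push_cast
    -- As c+c'+2 ≤ 0.59q, it suffices that 0.41s² - s + 1 > 0, whose discriminant is negative.
    nlinarith [sq_nonneg (0.82 * s - 1)]
  · have hmR : (2 : ℝ) ≤ m := by exact_mod_cast hm2
    have hQ : ∀ i : ℕ, 1 ≤ i → 4 * (i : ℝ) - 3 ≤ qNum q i := by
      intro i hi
      induction i, hi using Nat.le_induction with
      | base => norm_num [qNum_succ, qNum_zero]
      | succ i hi ih =>
        rw [qNum_succ]
        push_cast
        have : (1 : ℝ) ≤ qNum q i := by exact_mod_cast qNum_pos q (by omega)
        nlinarith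
    -- For m ≥ 2 crude bounds suffice: [m] ≥ 4m-3 ≥ 2m and q-√q ≥ q/2 give (q-√q)[m] ≥ qm.
    have h3 := hQ m (by omega)
    have h4 : (q : ℝ) / 2 ≤ q - s := by nlinarith
    have h5 : (q : ℝ) / 2 * (2 * m) ≤ (q - s) * qNum q m :=
      mul_le_mul h4 (by linarith) (by positivity) (by linarith)
    have h6 : (c + c' : ℝ) * m ≤ (0.59 * q - 2) * m :=
      mul_le_mul_of_nonneg_right (by linarith) (by linarith)
    nlinarith

section Core

variable {K V : Type*} [Field K] [AddCommGroup V] [Module K V] [Finite V]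

open scoped Classical in
-- Dimensions 1 to m contribute c each; dimension 0 contains only ⊥.
lemma FewBelow.card_le {c m : ℕ} {F : Finset (Submodule K V)} (hF : FewBelow c F)
    {x : Submodule K V} (hx : x ∈ F) (hxm : m < finrank K x) :
    #{y ∈ F | y ≤ x ∧ finrank K y ≤ m} ≤ c * m + 1 := by
  rw [card_eq_sum_card_fiberwise (f := fun y : Submodule K V => finrank K y) (t := range (m + 1))
    (fun y hy => by
      have := (mem_filter.1 hy).2.2
      simp only [coe_range, Set.mem_Iio]; omega), sum_range_succ', mul_comm]
  refine add_le_add ((sum_le_card_nsmul _ _ c fun j hj => ?_).trans (by simp)) ?_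
  · refine (card_le_card fun y hy => ?_).trans (hF x hx (j + 1) (by have := mem_range.1 hj; omega))
    simp only [mem_filter] at hy ⊢
    tauto
  · refine card_le_one.2 fun y hy z hz => ?_
    have h1 := (mem_filter.1 hy).2
    have h2 := (mem_filter.1 hz).2
    rw [Submodule.finrank_eq_zero] at h1 h2
    rw [h1, h2]

open scoped Classical in
lemma FewAbove.card_le {c m : ℕ} (hV : finrank K V = 2 * m + 1) {F : Finset (Submodule K V)}
    (hF : FewAbove c F) {x : Submodule K V} (hx : x ∈ F) (hxm : finrank K x ≤ m) :
    #{y ∈ F | x ≤ y ∧ m < finrank K y} ≤ c * m + 1 := by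
  rw [card_eq_sum_card_fiberwise (f := fun y : Submodule K V => finrank K V - finrank K y) (t := range (m + 1))
    (fun y hy => by
      have := (mem_filter.1 hy).2.2
      simp only [coe_range, Set.mem_Iio]; omega), sum_range_succ', mul_comm]
  refine add_le_add ((sum_le_card_nsmul _ _ c fun j hj => ?_).trans (by simp)) ?_
  · have := mem_range.1 hj
    refine (card_le_card fun y hy => ?_).trans (hF x hx (finrank K V - (j + 1)) (by omega))
    simp only [mem_filter] at hy ⊢
    exact ⟨hy.1.1, hy.1.2.1, by omega⟩
  · refine card_le_one.2 fun y hy z hz => ?_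
    have h1 := (mem_filter.1 hy).2
    have h2 := (mem_filter.1 hz).2
    rw [Submodule.eq_top_of_finrank_eq (le_antisymm (Submodule.finrank_le y) (by omega)),
      Submodule.eq_top_of_finrank_eq (le_antisymm (Submodule.finrank_le z) (by omega))]

variable [Finite K]

open scoped Classical in
/-- A family with members both of dimension at most `m` and at least `m + 1` is smaller than the
middle levels. -/
lemma card_lt_card_dimSet {m c c' : ℕ} (hV : finrank K V = 2 * m + 1)
    (hc : c < Nat.card K) (hc' : c' < Nat.card K)
    (hgap : (c * m + 1 : ℝ) + (c' * m + 1) <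
      qNum (Nat.card K) (m + 1) - √(Nat.card K) * qNum (Nat.card K) m)
    {F : Finset (Submodule K V)} (hF : FewAbove c F) (hF' : FewBelow c' F)
    (h1 : ∃ x ∈ F, finrank K x ≤ m) (h2 : ∃ x ∈ F, m < finrank K x) :
    #F < #(dimSet K V m) := by
  by_contra! hcon
  set F₁ : Finset (Submodule K V) := {x ∈ F | finrank K x ≤ m} with hF₁
  set F₂ : Finset (Submodule K V) := {x ∈ F | m < finrank K x} with hF₂
  have hsum : #F₁ + #F₂ = #F := by
    rw [← card_filter_add_card_filter_not (s := F) (fun x => finrank K x ≤ m)]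
    simp only [not_le, hF₁, hF₂]
  -- Both count conditions pass to subfamilies, so the shadow bounds give Hall's condition.
  obtain ⟨g, hg, hgm⟩ := exists_injOn_of_card_le (· ≤ ·) F₁ (dimSet K V m) fun T hT =>
    card_le_card_upperShadow hc hV.ge (hF.mono (hT.trans (filter_subset _ _)))
      fun x hx => (mem_filter.1 (hT hx)).2
  obtain ⟨h, hh, hhm⟩ := exists_injOn_of_card_le (fun x y => y ≤ x) F₂ (dimSet K V (m + 1))
    fun T hT => card_le_card_lowerShadow (m := m) hc' (by omega) (by omega)
      (hF'.mono (hT.trans (filter_subset _ _))) fun x hx => (mem_filter.1 (hT hx)).2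
  set A := F₁.image g
  set B := F₂.image h
  have hA : #A = #F₁ := card_image_of_injOn hg
  have hB : #B = #F₂ := card_image_of_injOn hh
  have hAs : A ⊆ dimSet K V m := fun a ha => by
    obtain ⟨x, hx, rfl⟩ := mem_image.1 ha
    exact (hgm x hx).1
  have hBs : B ⊆ dimSet K V (m + 1) := fun b hb => by
    obtain ⟨x, hx, rfl⟩ := mem_image.1 hb
    exact (hhm x hx).1
  have hmix := card_incidences_ge hV hAs hBs rfl (card_dimSet_middle hV) (by omega)
  have hbelow : ∀ Z ∈ B, #{W ∈ A | W ≤ Z} ≤ c' * m + 1 := by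
    intro Z hZ
    obtain ⟨x, hx, rfl⟩ := mem_image.1 hZ
    obtain ⟨hxF, hxm⟩ := mem_filter.1 hx
    refine le_trans ?_ (hF'.card_le hxF hxm)
    refine (card_le_card (t := image g _) fun W hW => ?_).trans card_image_le
    obtain ⟨hWA, hWZ⟩ := mem_filter.1 hW
    obtain ⟨y, hy, rfl⟩ := mem_image.1 hWA
    obtain ⟨hyF, hym⟩ := mem_filter.1 hy
    -- An incidence g y ≤ h x yields y ≤ g y ≤ h x ≤ x inside F.
    exact mem_image_of_mem g (mem_filter.2
      ⟨hyF, (hgm y hy).2.trans (hWZ.trans (hhm x hx).2), hym⟩)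
  have habove : ∀ W ∈ A, #{Z ∈ B | W ≤ Z} ≤ c * m + 1 := by
    intro W hW
    obtain ⟨x, hx, rfl⟩ := mem_image.1 hW
    obtain ⟨hxF, hxm⟩ := mem_filter.1 hx
    refine le_trans ?_ (hF.card_le hV hxF hxm)
    refine (card_le_card (t := image h _) fun Z hZ => ?_).trans card_image_le
    obtain ⟨hZB, hWZ⟩ := mem_filter.1 hZ
    obtain ⟨y, hy, rfl⟩ := mem_image.1 hZB
    obtain ⟨hyF, hym⟩ := mem_filter.1 hy
    exact mem_image_of_mem h (mem_filter.2
      ⟨hyF, (hgm x hx).2.trans (hWZ.trans (hhm y hy).2), hym⟩)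
  have hE₁ : ∑ Z ∈ B, #{W ∈ A | W ≤ Z} ≤ #B * (c' * m + 1) := by
    simpa using sum_le_card_nsmul _ _ _ hbelow
  have hE₂ : ∑ Z ∈ B, #{W ∈ A | W ≤ Z} ≤ #A * (c * m + 1) := by
    have := sum_card_bipartiteAbove_eq_sum_card_bipartiteBelow (s := A) (t := B) (· ≤ ·)
    simp only [bipartiteAbove, bipartiteBelow] at this
    rw [← this]
    simpa using sum_le_card_nsmul _ _ _ habove
  have hApos : 0 < #A := by
    obtain ⟨x, hx, hxm⟩ := h1
    exact hA ▸ card_pos.2 ⟨x, mem_filter.2 ⟨hx, hxm⟩⟩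
  have hBpos : 0 < #B := by
    obtain ⟨x, hx, hxm⟩ := h2
    exact hB ▸ card_pos.2 ⟨x, mem_filter.2 ⟨hx, hxm⟩⟩
  have hN : #(dimSet K V m) ≤ #A + #B := by omega
  rw [← Nat.cast_sum] at hmix
  set E := ∑ Z ∈ B, #{W ∈ A | W ≤ Z}
  set G : ℝ := qNum (Nat.card K) (m + 1) - √(Nat.card K) * qNum (Nat.card K) m
  set N := #(dimSet K V m)
  have hE₁' : (E : ℝ) ≤ #B * (c' * m + 1) := by exact_mod_cast hE₁
  have hE₂' : (E : ℝ) ≤ #A * (c * m + 1) := by exact_mod_cast hE₂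
  have hN' : (N : ℝ) ≤ #A + #B := by exact_mod_cast hN
  have hA' : (0 : ℝ) < #A := by exact_mod_cast hApos
  have hB' : (0 : ℝ) < #B := by exact_mod_cast hBpos
  have hN0 : (0 : ℝ) < N := hA'.trans_le (by exact_mod_cast card_le_card hAs)
  have k1 : G * #A ≤ N * (c' * m + 1) := by
    refine le_of_mul_le_mul_right ?_ hB'
    have := mul_le_mul_of_nonneg_left hE₁' hN0.le
    linarith
  have k2 : G * #B ≤ N * (c * m + 1) := by
    refine le_of_mul_le_mul_right ?_ hA'
    have := mul_le_mul_of_nonneg_left hE₂' hN0.le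
    linarith
  have hG : 0 < G := lt_trans (by positivity) hgap
  -- Adding `k1` and `k2` and using N ≤ |A|+|B| gives GN ≤ N((cm+1)+(c'm+1)), against `hgap`.
  have k3 := mul_le_mul_of_nonneg_left hN' hG.le
  have k4 := mul_lt_mul_of_pos_left hgap hN0
  linarith

/-- A family with few comparabilities has at most as many members as a middle level, with equality
only for the middle levels. -/
lemma card_le_card_dimSet {m c c' : ℕ} (hV : finrank K V = 2 * m + 1)
    (hc : c < Nat.card K) (hc' : c' < Nat.card K)
    (hgap : (c * m + 1 : ℝ) + (c' * m + 1) <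
      qNum (Nat.card K) (m + 1) - √(Nat.card K) * qNum (Nat.card K) m)
    {F : Finset (Submodule K V)} (hF : FewAbove c F) (hF' : FewBelow c' F) :
    #F ≤ #(dimSet K V m) ∧
      (#F = #(dimSet K V m) → F = dimSet K V m ∨ F = dimSet K V (m + 1)) := by
  by_cases h1 : ∃ x ∈ F, finrank K x ≤ m
  · by_cases h2 : ∃ x ∈ F, m < finrank K x
    · have h := card_lt_card_dimSet hV hc hc' hgap hF hF' h1 h2
      exact ⟨h.le, fun he => absurd he h.ne⟩
    · push Not at h2
      by_cases h3 : ∃ x ∈ F, finrank K x < m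
      · have h := card_lt_card_dimSet_of_exists_lt hc hV.ge hF h2 h3
        exact ⟨h.le, fun he => absurd he h.ne⟩
      · push Not at h3
        have hs : F ⊆ dimSet K V m := fun x hx => mem_dimSet.2 (le_antisymm (h2 x hx) (h3 x hx))
        exact ⟨card_le_card hs, fun he => Or.inl (eq_of_subset_of_card_le hs he.ge)⟩
  · push Not at h1
    rw [← card_dimSet_middle hV]
    by_cases h3 : ∃ x ∈ F, m + 1 < finrank K x
    · have h := card_lt_card_dimSet_of_exists_gt (m := m) hc' (by omega) (by omega) hF' h1 h3
      exact ⟨h.le, fun he => absurd he h.ne⟩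
    · push Not at h3
      have hs : F ⊆ dimSet K V (m + 1) := fun x hx =>
        mem_dimSet.2 (le_antisymm (h3 x hx) (h1 x hx))
      exact ⟨card_le_card hs, fun he => Or.inr (eq_of_subset_of_card_le hs he.ge)⟩

end Core

/-! ### The main theorem. -/

theorem mainTheorem1 {K V : Type*} [Field K] [Finite K] [AddCommGroup V] [Module K V]
    (q n k l : ℕ) (hq : Nat.card K = q) (hV : Module.finrank K V = n)
    (hn : Odd n) (hn3 : 3 ≤ n) (hk : 1 ≤ k) (hl : 1 ≤ l)
    (hkq : (k : ℝ) ≤ (1 - Real.sqrt 2 / 2) * q)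
    (hlq : (l : ℝ) ≤ (1 - Real.sqrt 2 / 2) * q) :
    (LaStar K V {FinPartOrd.of (VPoset k), FinPartOrd.of (LambdaPoset l)} : ℚ)
        = qBinom q n ((n - 1) / 2) ∧
      ∀ F : Finset (Submodule K V),
        InducedFree {FinPartOrd.of (VPoset k), FinPartOrd.of (LambdaPoset l)} F →
        F.card = LaStar K V {FinPartOrd.of (VPoset k), FinPartOrd.of (LambdaPoset l)} →
        (F : Set (Submodule K V)) = level K V ((n - 1) / 2) ∨
          (F : Set (Submodule K V)) = level K V ((n + 1) / 2) := by
  obtain ⟨m, rfl⟩ := hn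
  subst hq
  -- `finrank` defaults to 0 in infinite dimension, so n > 0 rules that case out.
  have : FiniteDimensional K V := FiniteDimensional.of_finrank_pos (by omega)
  have : Finite V := Module.finite_of_finite K
  obtain ⟨c, rfl⟩ := Nat.exists_eq_add_of_le' hk
  obtain ⟨c', rfl⟩ := Nat.exists_eq_add_of_le' hl
  rw [show (2 * m + 1 - 1) / 2 = m by omega, show (2 * m + 1 + 1) / 2 = m + 1 by omega]
  have hlt : ∀ {i : ℕ}, ((i + 1 : ℕ) : ℝ) ≤ (1 - √2 / 2) * Nat.card K → i < Nat.card K := by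
    intro i hi
    have h1 : (1 - √2 / 2) * (Nat.card K : ℝ) ≤ 1 * Nat.card K :=
      mul_le_mul_of_nonneg_right (by linarith [Real.sqrt_nonneg 2]) (Nat.cast_nonneg _)
    rw [one_mul] at h1
    exact_mod_cast hi.trans h1
  have hcore : ∀ F : Finset (Submodule K V),
      InducedFree {FinPartOrd.of (VPoset (c + 1)), FinPartOrd.of (LambdaPoset (c' + 1))} F →
      #F ≤ #(dimSet K V m) ∧
        (#F = #(dimSet K V m) → F = dimSet K V m ∨ F = dimSet K V (m + 1)) := fun F hF =>
    card_le_card_dimSet hV (hlt hkq) (hlt hlq) (incidence_bound_lt_gap (by omega) hkq hlq)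
      (hF.fewAbove (Or.inl rfl)) (hF.fewBelow (Or.inr rfl))
  have hLa : LaStar K V {FinPartOrd.of (VPoset (c + 1)), FinPartOrd.of (LambdaPoset (c' + 1))} =
      #(dimSet K V m) := by
    refine IsGreatest.csSup_eq ⟨⟨_, inducedFree_dimSet hk hl m, rfl⟩, ?_⟩
    rintro _ ⟨F, hF, rfl⟩
    exact (hcore F hF).1
  rw [hLa]
  refine ⟨?_, fun F hF hFc => ?_⟩
  · rw [card_dimSet_eq_qBinom m (by omega), hV]
  · rcases (hcore F hF).2 hFc with rfl | rfl
    · exact Or.inl (Set.Finite.coe_toFinset _)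
    · exact Or.inr (Set.Finite.coe_toFinset _)
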